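/- **Theorem 4.3.** Let $(M_1^m,g_1,J)$ be a Kähler manifold (an almost Hermitian manifold, $J^2=-I$, $g_1(JX,JY)=g_1(X,Y)$, with $\nabla^1 J=0$ for the Levi-Civita connection $\nabla^1$ of $g_1$), let $(M_2^n,g_2)$ be a Riemannian manifold with $m>n$ (real dimensions), and let $F:M_1\to M_2$ be a semi-invariant Riemannian submersion. That is, $F$ is a smooth surjective map of maximal rank whose differential is isometric on $(\ker F_*)^\perp$, and there is a smooth distribution $\mathcal D_1\subseteq\ker F_*$ such that, with $\mathcal D_2$ the orthogonal complement of $\mathcal D_1$ in $\ker F_*$, $$J\mathcal D_1=\mathcal D_1,\qquad J\mathcal D_2\subseteq(\ker F_*)^\perp .$$ Let $\mu$ be the orthogonal complement of $J\mathcal D_2$ in $(\ker F_*)^\perp$, and assume that $\mathcal D_1\neq\{0\}$ or $\mu=\{0\}$. Suppose that the fibers of $F$ are totally umbilical: $\mathcal T_XY=g_1(X,Y)H$ for all vertical vector fields $X,Y$, where, with $\mathcal V$ and $\mathcal H$ the orthogonal projections onto $\ker F_*$ and $(\ker F_*)^\perp$, $\mathcal T_XY=\mathcal H\nabla^1_{\mathcal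 VX}\mathcal VY+\mathcal V\nabla^1_{\mathcal VX}\mathcal HY$ is O'Neill's tensor (on vertical fields, the second fundamental form of the fibers) and $H$ is the mean curvature vector field of the fibers. Then either $\mathcal D_2$ is one-dimensional, or the fibers are totally geodesic, i.e. $\mathcal T_XY=0$ for all vertical $X,Y$. -/

import Mathlib

open Bundle Manifold Module
open scoped ContDiff InnerProductSpace Topology

set_option linter.unusedSectionVars false

noncomputable section

namespace RiemSubm

/-! ### The Levi-Civita connection -/

section LeviCivita

instance finiteDimensional_tangentSpace
    {E : Type*} [NormedAddCommGroup E] [NormedSpace ℝ E] [FiniteDimensional ℝ E]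
    {H : Type*} [TopologicalSpace H] (I : ModelWithCorners ℝ E H)
    {M : Type*} [TopologicalSpace M] [ChartedSpace H M] (x : M) :
    FiniteDimensional ℝ (TangentSpace I x) :=
  inferInstanceAs (FiniteDimensional ℝ E)

variable {E : Type*} [NormedAddCommGroup E] [NormedSpace ℝ E] [FiniteDimensional ℝ E]
  {H : Type*} [TopologicalSpace H] {I : ModelWithCorners ℝ E H}
  {M : Type*} [TopologicalSpace M] [ChartedSpace H M] [IsManifold I ∞ M]
  [RiemannianBundle (fun x : M ↦ TangentSpace I x)]
  [IsContMDiffRiemannianBundle I ∞ E (fun x : M ↦ TangentSpace I x)]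

variable (I) in
/-- The right-hand side of the Koszul formula, i.e. `g(∇_X Y, Z)` at `p`, where
`2 g(∇_X Y, Z) = X g(Y, Z) + Y g(Z, X) - Z g(X, Y) + g([X, Y], Z) - g([Y, Z], X) + g([Z, X], Y)`. -/
def koszul (X Y Z : Π x : M, TangentSpace I x) (p : M) : ℝ :=
  (1 / 2) * (mvfderiv I (fun q ↦ ⟪Y q, Z q⟫_ℝ) p (X p) + mvfderiv I (fun q ↦ ⟪Z q, X q⟫_ℝ) p (Y p)
    - mvfderiv I (fun q ↦ ⟪X q, Y q⟫_ℝ) p (Z p)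
    + ⟪VectorField.mlieBracket I X Y p, Z p⟫_ℝ - ⟪VectorField.mlieBracket I Y Z p, X p⟫_ℝ
    + ⟪VectorField.mlieBracket I Z X p, Y p⟫_ℝ)

theorem mdiff_inner {X Y : Π x : M, TangentSpace I x} {p : M}
    (hX : MDiffAt (T% X) p) (hY : MDiffAt (T% Y) p) : MDiffAt (fun q ↦ ⟪X q, Y q⟫_ℝ) p :=
  MDifferentiableAt.inner_bundle (E := fun x : M ↦ TangentSpace I x) (F := E) hX hY

theorem koszul_tensorial_left {Y Z : Π x : M, TangentSpace I x} {p : M}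
    (hY : MDiffAt (T% Y) p) (hZ : MDiffAt (T% Z) p) :
    TensorialAt I E (fun X ↦ koszul I X Y Z p) p where
  smul {f X} hf hX := by
    have h1 : MDiffAt (fun q ↦ ⟪Z q, X q⟫_ℝ) p := mdiff_inner hZ hX
    have h2 : MDiffAt (fun q ↦ ⟪X q, Y q⟫_ℝ) p := mdiff_inner hX hY
    have e1 : (fun q ↦ ⟪Z q, (f • X) q⟫_ℝ) = fun q ↦ f q * ⟪Z q, X q⟫_ℝ := by
      ext q; simp [inner_smul_right]
    have e2 : (fun q ↦ ⟪(f • X) q, Y q⟫_ℝ) = fun q ↦ f q * ⟪X q, Y q⟫_ℝ := by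
      ext q; simp [inner_smul_left]
    simp only [koszul, e1, e2, mvfderiv_fun_mul hf h1, mvfderiv_fun_mul hf h2,
      VectorField.mlieBracket_smul_left hf hX, VectorField.mlieBracket_smul_right hf hX]
    simp [inner_add_left, inner_smul_left, inner_smul_right, real_inner_comm]
    ring
  add {X X'} hX hX' := by
    have h1 : MDiffAt (fun q ↦ ⟪Z q, X q⟫_ℝ) p := mdiff_inner hZ hX
    have h2 : MDiffAt (fun q ↦ ⟪X q, Y q⟫_ℝ) p := mdiff_inner hX hY
    have h1' : MDiffAt (fun q ↦ ⟪Z q, X' q⟫_ℝ) p := mdiff_inner hZ hX'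
    have h2' : MDiffAt (fun q ↦ ⟪X' q, Y q⟫_ℝ) p := mdiff_inner hX' hY
    simp only [koszul, Pi.add_apply, inner_add_left, inner_add_right, mvfderiv_fun_add h1 h1',
      mvfderiv_fun_add h2 h2', VectorField.mlieBracket_add_left hX hX',
      VectorField.mlieBracket_add_right hX hX', map_add, add_apply]
    ring

theorem koszul_tensorial_right {X Y : Π x : M, TangentSpace I x} {p : M}
    (hX : MDiffAt (T% X) p) (hY : MDiffAt (T% Y) p) :
    TensorialAt I E (fun Z ↦ koszul I X Y Z p) p where
  smul {f Z} hf hZ := by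
    have h1 : MDiffAt (fun q ↦ ⟪Y q, Z q⟫_ℝ) p := mdiff_inner hY hZ
    have h2 : MDiffAt (fun q ↦ ⟪Z q, X q⟫_ℝ) p := mdiff_inner hZ hX
    have e1 : (fun q ↦ ⟪Y q, (f • Z) q⟫_ℝ) = fun q ↦ f q * ⟪Y q, Z q⟫_ℝ := by
      ext q; simp [inner_smul_right]
    have e2 : (fun q ↦ ⟪(f • Z) q, X q⟫_ℝ) = fun q ↦ f q * ⟪Z q, X q⟫_ℝ := by
      ext q; simp [inner_smul_left]
    simp only [koszul, e1, e2, mvfderiv_fun_mul hf h1, mvfderiv_fun_mul hf h2,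
      VectorField.mlieBracket_smul_left hf hZ, VectorField.mlieBracket_smul_right hf hZ]
    simp [inner_add_left, inner_smul_left, inner_smul_right, real_inner_comm]
    ring
  add {Z Z'} hZ hZ' := by
    have h1 : MDiffAt (fun q ↦ ⟪Y q, Z q⟫_ℝ) p := mdiff_inner hY hZ
    have h2 : MDiffAt (fun q ↦ ⟪Z q, X q⟫_ℝ) p := mdiff_inner hZ hX
    have h1' : MDiffAt (fun q ↦ ⟪Y q, Z' q⟫_ℝ) p := mdiff_inner hY hZ'
    have h2' : MDiffAt (fun q ↦ ⟪Z' q, X q⟫_ℝ) p := mdiff_inner hZ' hX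
    simp only [koszul, Pi.add_apply, inner_add_left, inner_add_right, mvfderiv_fun_add h1 h1',
      mvfderiv_fun_add h2 h2', VectorField.mlieBracket_add_left hZ hZ',
      VectorField.mlieBracket_add_right hZ hZ', map_add, add_apply]
    ring

theorem koszul_add {X Y Y' Z : Π x : M, TangentSpace I x} {p : M} (hX : MDiffAt (T% X) p)
    (hY : MDiffAt (T% Y) p) (hY' : MDiffAt (T% Y') p) (hZ : MDiffAt (T% Z) p) :
    koszul I X (Y + Y') Z p = koszul I X Y Z p + koszul I X Y' Z p := by
  have h1 : MDiffAt (fun q ↦ ⟪Y q, Z q⟫_ℝ) p := mdiff_inner hY hZ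
  have h2 : MDiffAt (fun q ↦ ⟪X q, Y q⟫_ℝ) p := mdiff_inner hX hY
  have h1' : MDiffAt (fun q ↦ ⟪Y' q, Z q⟫_ℝ) p := mdiff_inner hY' hZ
  have h2' : MDiffAt (fun q ↦ ⟪X q, Y' q⟫_ℝ) p := mdiff_inner hX hY'
  simp only [koszul, Pi.add_apply, inner_add_left, inner_add_right, mvfderiv_fun_add h1 h1',
    mvfderiv_fun_add h2 h2', VectorField.mlieBracket_add_left hY hY',
    VectorField.mlieBracket_add_right hY hY', map_add, add_apply]
  ring

theorem koszul_leibniz {X Y Z : Π x : M, TangentSpace I x} {f : M → ℝ} {p : M}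
    (hX : MDiffAt (T% X) p) (hY : MDiffAt (T% Y) p) (hZ : MDiffAt (T% Z) p) (hf : MDiffAt f p) :
    koszul I X (f • Y) Z p = f p * koszul I X Y Z p + mvfderiv I f p (X p) * ⟪Y p, Z p⟫_ℝ := by
  have h1 : MDiffAt (fun q ↦ ⟪Y q, Z q⟫_ℝ) p := mdiff_inner hY hZ
  have h2 : MDiffAt (fun q ↦ ⟪X q, Y q⟫_ℝ) p := mdiff_inner hX hY
  have e1 : (fun q ↦ ⟪(f • Y) q, Z q⟫_ℝ) = fun q ↦ f q * ⟪Y q, Z q⟫_ℝ := by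
    ext q; simp [inner_smul_left]
  have e2 : (fun q ↦ ⟪X q, (f • Y) q⟫_ℝ) = fun q ↦ f q * ⟪X q, Y q⟫_ℝ := by
    ext q; simp [inner_smul_right]
  simp only [koszul, e1, e2, mvfderiv_fun_mul hf h1, mvfderiv_fun_mul hf h2,
    VectorField.mlieBracket_smul_left hf hY, VectorField.mlieBracket_smul_right hf hY]
  simp [inner_add_left, inner_smul_left, inner_smul_right, real_inner_comm]
  ring

theorem koszul_metric (X Y Z : Π x : M, TangentSpace I x) (p : M) :
    koszul I X Y Z p + koszul I X Z Y p = mvfderiv I (fun q ↦ ⟪Y q, Z q⟫_ℝ) p (X p) := by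
  simp only [koszul, VectorField.mlieBracket_swap_apply (V := Y) (W := X),
    VectorField.mlieBracket_swap_apply (V := Z) (W := Y),
    VectorField.mlieBracket_swap_apply (V := Z) (W := X),
    inner_neg_left, real_inner_comm]
  simp only [fun q ↦ real_inner_comm (Z q) (Y q), fun q ↦ real_inner_comm (Z q) (X q),
    fun q ↦ real_inner_comm (Y q) (X q)]
  ring

theorem koszul_torsion (X Y Z : Π x : M, TangentSpace I x) (p : M) :
    koszul I X Y Z p - koszul I Y X Z p = ⟪VectorField.mlieBracket I X Y p, Z p⟫_ℝ := by
  simp only [koszul, VectorField.mlieBracket_swap_apply (V := Y) (W := X),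
    VectorField.mlieBracket_swap_apply (V := Z) (W := Y),
    VectorField.mlieBracket_swap_apply (V := Z) (W := X),
    inner_neg_left]
  simp only [fun q ↦ real_inner_comm (Z q) (Y q), fun q ↦ real_inner_comm (Z q) (X q),
    fun q ↦ real_inner_comm (Y q) (X q)]
  ring

/-- For a vector field `Y` differentiable at `p`, the bilinear form `(u, w) ↦ g(∇_u Y, w)` on the
tangent space at `p`. -/
def koszulForm {Y : Π x : M, TangentSpace I x} {p : M} (hY : MDiffAt (T% Y) p) :
    TangentSpace I p →L[ℝ] TangentSpace I p →L[ℝ] ℝ :=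
  TensorialAt.mkHom₂ (I := I) (F := E) (F' := E) (V := fun x : M ↦ TangentSpace I x)
    (V' := fun x : M ↦ TangentSpace I x) (fun X Z ↦ koszul I X Y Z p) p
    (fun _ hZ ↦ koszul_tensorial_left hY hZ) (fun _ hX ↦ koszul_tensorial_right hX hY)

theorem koszulForm_apply {X Y Z : Π x : M, TangentSpace I x} {p : M}
    (hX : MDiffAt (T% X) p) (hY : MDiffAt (T% Y) p) (hZ : MDiffAt (T% Z) p) :
    koszulForm hY (X p) (Z p) = koszul I X Y Z p :=
  TensorialAt.mkHom₂_apply (I := I) (F := E) (F' := E) (V := fun x : M ↦ TangentSpace I x)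
    (V' := fun x : M ↦ TangentSpace I x)
    (fun _ hZ ↦ koszul_tensorial_left hY hZ) (fun _ hX ↦ koszul_tensorial_right hX hY) hX hZ

open Classical in
variable (I) in
/-- The covariant differential `u ↦ ∇_u Y` at `p`: the vector `∇_u Y` is the one representing the
functional `w ↦ g(∇_u Y, w)` given by the Koszul formula (and a junk value `0` is used at points
where `Y` is not differentiable). -/
def leviCivitaFun (Y : Π x : M, TangentSpace I x) (p : M) :
    TangentSpace I p →L[ℝ] TangentSpace I p :=
  if hY : MDiffAt (T% Y) p then
    ∑ i, ((koszulForm hY).flip (stdOrthonormalBasis ℝ (TangentSpace I p) i)).smulRight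
      (stdOrthonormalBasis ℝ (TangentSpace I p) i)
  else 0

theorem inner_leviCivitaFun {X Y Z : Π x : M, TangentSpace I x} {p : M}
    (hX : MDiffAt (T% X) p) (hY : MDiffAt (T% Y) p) (hZ : MDiffAt (T% Z) p) :
    ⟪leviCivitaFun I Y p (X p), Z p⟫_ℝ = koszul I X Y Z p := by
  rw [leviCivitaFun, dif_pos hY, ← koszulForm_apply hX hY hZ]
  conv_rhs => rw [← (stdOrthonormalBasis ℝ (TangentSpace I p)).sum_repr' (Z p)]
  simp [sum_inner, inner_smul_left, mul_comm]

theorem inner_leviCivitaFun_extend {Y : Π x : M, TangentSpace I x} {p : M}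
    (hY : MDiffAt (T% Y) p) (u w : TangentSpace I p) :
    ⟪leviCivitaFun I Y p u, w⟫_ℝ =
      koszul I (FiberBundle.extend E u) Y (FiberBundle.extend E w) p := by
  rw [← inner_leviCivitaFun (FiberBundle.mdifferentiableAt_extend ..) hY
    (FiberBundle.mdifferentiableAt_extend ..)]
  simp

variable (I M) in
/-- The Levi-Civita connection of a Riemannian manifold, on the tangent bundle: `leviCivita I M Y p u`
is `∇_u Y` at `p`. -/
def leviCivita : CovariantDerivative I E (TangentSpace I : M → Type _) where
  toFun := leviCivitaFun I
  isCovariantDerivativeOnUniv :=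
    { add := by
        intro Y Y' p hY hY' _
        ext u
        refine ext_inner_right ℝ fun w ↦ ?_
        rw [add_apply, inner_add_left, inner_leviCivitaFun_extend (mdifferentiableAt_add_section hY hY'),
          inner_leviCivitaFun_extend hY, inner_leviCivitaFun_extend hY']
        exact koszul_add (FiberBundle.mdifferentiableAt_extend ..) hY hY' (FiberBundle.mdifferentiableAt_extend ..)
      leibniz := by
        intro Y f p hY hf _
        ext u
        refine ext_inner_right ℝ fun w ↦ ?_
        rw [inner_leviCivitaFun_extend (hf.smul_section hY),
          koszul_leibniz (FiberBundle.mdifferentiableAt_extend ..) hY (FiberBundle.mdifferentiableAt_extend ..) hf,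
          ← inner_leviCivitaFun_extend hY]
        simp [inner_add_left, inner_smul_left] }

/-- The Levi-Civita connection is metric. -/
theorem leviCivita_metric {X Y Z : Π x : M, TangentSpace I x} {p : M}
    (hX : MDiffAt (T% X) p) (hY : MDiffAt (T% Y) p) (hZ : MDiffAt (T% Z) p) :
    mvfderiv I (fun q ↦ ⟪Y q, Z q⟫_ℝ) p (X p) =
      ⟪leviCivita I M Y p (X p), Z p⟫_ℝ + ⟪Y p, leviCivita I M Z p (X p)⟫_ℝ := by
  rw [← koszul_metric, real_inner_comm (leviCivita I M Z p (X p)) (Y p),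
    ← inner_leviCivitaFun hX hY hZ, ← inner_leviCivitaFun hX hZ hY]
  rfl

/-- The Levi-Civita connection is torsion free. -/
theorem leviCivita_torsionFree {X Y : Π x : M, TangentSpace I x} {p : M}
    (hX : MDiffAt (T% X) p) (hY : MDiffAt (T% Y) p) :
    leviCivita I M Y p (X p) - leviCivita I M X p (Y p) = VectorField.mlieBracket I X Y p := by
  refine ext_inner_right ℝ fun w ↦ ?_
  have hw : MDiffAt (T% (FiberBundle.extend E w)) p := FiberBundle.mdifferentiableAt_extend ..
  have h := koszul_torsion X Y (FiberBundle.extend E w) p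
  rw [← inner_leviCivitaFun hX hY hw, ← inner_leviCivitaFun hY hX hw] at h
  rw [inner_sub_left]
  rw [FiberBundle.extend_apply_self] at h
  exact h
end LeviCivita

/-! ### Almost Hermitian and Kähler manifolds -/

section Kahler

variable {E : Type*} [NormedAddCommGroup E] [NormedSpace ℝ E] [FiniteDimensional ℝ E]
  {H : Type*} [TopologicalSpace H] (I : ModelWithCorners ℝ E H)
  {M : Type*} [TopologicalSpace M] [ChartedSpace H M] [IsManifold I ∞ M]

/-- The vector field `X` is smooth at the point `p`. -/
def SmoothFieldAt (X : Π x : M, TangentSpace I x) (p : M) : Prop :=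
  ContMDiffAt I I.tangent ∞ (fun x ↦ (⟨x, X x⟩ : TangentBundle I M)) p

/-- `D` is a smooth distribution of rank `r`: locally it is spanned by `r` smooth vector fields
which are linearly independent at every point. -/
def IsSmoothDistribution (r : ℕ) (D : Π x : M, Submodule ℝ (TangentSpace I x)) : Prop :=
  ∀ p : M, ∃ U : Set M, IsOpen U ∧ p ∈ U ∧ ∃ X : Fin r → Π x : M, TangentSpace I x,
    ∀ q ∈ U, (∀ i, SmoothFieldAt I (X i) q) ∧ LinearIndependent ℝ (fun i ↦ X i q) ∧
      Submodule.span ℝ (Set.range fun i ↦ X i q) = D q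

variable [RiemannianBundle (fun x : M ↦ TangentSpace I x)]
  [IsContMDiffRiemannianBundle I ∞ E (fun x : M ↦ TangentSpace I x)]

/-- `J` is a smooth almost complex structure on `M` compatible with the metric: `J² = -1` and
`g(JX, JY) = g(X, Y)`. Smoothness of the tensor field `J` means that it maps smooth vector fields to
smooth vector fields. -/
structure IsAlmostHermitian (J : Π x : M, TangentSpace I x →L[ℝ] TangentSpace I x) : Prop where
  smooth : ∀ (Y : Π x : M, TangentSpace I x) (p : M), SmoothFieldAt I Y p →
    SmoothFieldAt I (fun x ↦ J x (Y x)) p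
  sq : ∀ (p : M) (v : TangentSpace I p), J p (J p v) = -v
  inner_map : ∀ (p : M) (v w : TangentSpace I p), ⟪J p v, J p w⟫_ℝ = ⟪v, w⟫_ℝ

/-- `(M, g, J)` is Kähler: it is almost Hermitian and `(∇_X J) Y = ∇_X (J Y) - J (∇_X Y) = 0` for
the Levi-Civita connection `∇`. -/
structure IsKahler (J : Π x : M, TangentSpace I x →L[ℝ] TangentSpace I x) : Prop extends
    IsAlmostHermitian I J where
  parallel : ∀ (Y : Π x : M, TangentSpace I x) (p : M), SmoothFieldAt I Y p →
    ∀ u : TangentSpace I p,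
      leviCivita I M (fun x ↦ J x (Y x)) p u - J p (leviCivita I M Y p u) = 0

end Kahler

/-! ### Riemannian submersions -/

section Submersion

variable {E₁ : Type*} [NormedAddCommGroup E₁] [NormedSpace ℝ E₁] [FiniteDimensional ℝ E₁]
  {H₁ : Type*} [TopologicalSpace H₁] (I₁ : ModelWithCorners ℝ E₁ H₁)
  {M₁ : Type*} [TopologicalSpace M₁] [ChartedSpace H₁ M₁] [IsManifold I₁ ∞ M₁]
  [RiemannianBundle (fun x : M₁ ↦ TangentSpace I₁ x)]
  [IsContMDiffRiemannianBundle I₁ ∞ E₁ (fun x : M₁ ↦ TangentSpace I₁ x)]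
  {E₂ : Type*} [NormedAddCommGroup E₂] [NormedSpace ℝ E₂] [FiniteDimensional ℝ E₂]
  {H₂ : Type*} [TopologicalSpace H₂] (I₂ : ModelWithCorners ℝ E₂ H₂)
  {M₂ : Type*} [TopologicalSpace M₂] [ChartedSpace H₂ M₂] [IsManifold I₂ ∞ M₂]
  [RiemannianBundle (fun x : M₂ ↦ TangentSpace I₂ x)]
  [IsContMDiffRiemannianBundle I₂ ∞ E₂ (fun x : M₂ ↦ TangentSpace I₂ x)]

/-- The vertical space `ker F_*` at `p`, the tangent space of the fiber through `p`. -/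
def vertical (F : M₁ → M₂) (p : M₁) : Submodule ℝ (TangentSpace I₁ p) :=
  LinearMap.ker (mfderiv I₁ I₂ F p).toLinearMap

/-- The horizontal space `(ker F_*)^⊥` at `p`. -/
def horizontal (F : M₁ → M₂) (p : M₁) : Submodule ℝ (TangentSpace I₁ p) :=
  (vertical I₁ I₂ F p)ᗮ

/-- The vertical part `𝒱X` of a vector field. -/
def verPart (F : M₁ → M₂) (X : Π x : M₁, TangentSpace I₁ x) : Π x : M₁, TangentSpace I₁ x :=
  fun p ↦ (vertical I₁ I₂ F p).starProjection (X p)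

/-- The horizontal part `ℋX` of a vector field. -/
def horPart (F : M₁ → M₂) (X : Π x : M₁, TangentSpace I₁ x) : Π x : M₁, TangentSpace I₁ x :=
  fun p ↦ (horizontal I₁ I₂ F p).starProjection (X p)

/-- A Riemannian submersion: a smooth surjective map of maximal rank whose differential is isometric
on horizontal vectors. -/
structure IsRiemannianSubmersion (F : M₁ → M₂) : Prop where
  smooth : ContMDiff I₁ I₂ ∞ F
  surjective : Function.Surjective F
  maximalRank : ∀ p : M₁, Function.Surjective (mfderiv I₁ I₂ F p)
  isometric : ∀ p : M₁, ∀ u ∈ horizontal I₁ I₂ F p, ∀ v ∈ horizontal I₁ I₂ F p,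
    ⟪mfderiv I₁ I₂ F p u, mfderiv I₁ I₂ F p v⟫_ℝ = ⟪u, v⟫_ℝ

/-- O'Neill's tensor `𝒯_X Y = ℋ ∇_{𝒱X} 𝒱Y + 𝒱 ∇_{𝒱X} ℋY`. For vertical `X`, `Y` it is the second
fundamental form of the fibers. -/
def oneillT (F : M₁ → M₂) (X Y : Π x : M₁, TangentSpace I₁ x) : Π x : M₁, TangentSpace I₁ x :=
  fun p ↦
    (horizontal I₁ I₂ F p).starProjection
      (leviCivita I₁ M₁ (verPart I₁ I₂ F Y) p (verPart I₁ I₂ F X p)) +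
    (vertical I₁ I₂ F p).starProjection
      (leviCivita I₁ M₁ (horPart I₁ I₂ F Y) p (verPart I₁ I₂ F X p))

/-- The mean curvature vector field `H` of the fibers: `H p = (1/k) ∑ i, 𝒯_{e i} (e i)`, for an
orthonormal basis `e 1, …, e k` of the vertical space at `p`. The tensor is evaluated at tangent
vectors by extending them to vector fields which are smooth at `p`. -/
def meanCurvature (F : M₁ → M₂) (p : M₁) : TangentSpace I₁ p :=
  (finrank ℝ (vertical I₁ I₂ F p) : ℝ)⁻¹ •
    ∑ i, oneillT I₁ I₂ F
      (FiberBundle.extend E₁ (stdOrthonormalBasis ℝ (vertical I₁ I₂ F p) i : TangentSpace I₁ p))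
      (FiberBundle.extend E₁ (stdOrthonormalBasis ℝ (vertical I₁ I₂ F p) i : TangentSpace I₁ p)) p

/-- The fibers are totally umbilical: `𝒯_X Y = g(X, Y) H` for vertical `X`, `Y`, where `H` is the
mean curvature vector field of the fibers. -/
def HasTotallyUmbilicalFibers (F : M₁ → M₂) : Prop :=
  ∀ X Y : Π x : M₁, TangentSpace I₁ x,
    (∀ q, X q ∈ vertical I₁ I₂ F q) → (∀ q, Y q ∈ vertical I₁ I₂ F q) →
    ∀ p : M₁, SmoothFieldAt I₁ X p → SmoothFieldAt I₁ Y p →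
      oneillT I₁ I₂ F X Y p = ⟪X p, Y p⟫_ℝ • meanCurvature I₁ I₂ F p

/-- The fibers are totally geodesic: their second fundamental form, the restriction of `𝒯` to
vertical vector fields, vanishes. -/
def HasTotallyGeodesicFibers (F : M₁ → M₂) : Prop :=
  ∀ X Y : Π x : M₁, TangentSpace I₁ x,
    (∀ q, X q ∈ vertical I₁ I₂ F q) → (∀ q, Y q ∈ vertical I₁ I₂ F q) →
    ∀ p : M₁, SmoothFieldAt I₁ X p → SmoothFieldAt I₁ Y p → oneillT I₁ I₂ F X Y p = 0

/-- `𝒟₂`, the orthogonal complement of `𝒟₁` in `ker F_*`. -/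
def distD2 (F : M₁ → M₂) (D₁ : Π x : M₁, Submodule ℝ (TangentSpace I₁ x)) (p : M₁) :
    Submodule ℝ (TangentSpace I₁ p) :=
  vertical I₁ I₂ F p ⊓ (D₁ p)ᗮ

/-- `F` is a semi-invariant Riemannian submersion with respect to the almost complex structure `J`
and the distribution `𝒟₁ ⊆ ker F_*`: `J 𝒟₁ = 𝒟₁` and `J 𝒟₂ ⊆ (ker F_*)^⊥`. -/
structure IsSemiInvariantSubmersion (J : Π x : M₁, TangentSpace I₁ x →L[ℝ] TangentSpace I₁ x)
    (F : M₁ → M₂) (D₁ : Π x : M₁, Submodule ℝ (TangentSpace I₁ x)) : Prop extends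
    IsRiemannianSubmersion I₁ I₂ F where
  distribution : ∃ r, IsSmoothDistribution I₁ r D₁
  le_vertical : ∀ p, D₁ p ≤ vertical I₁ I₂ F p
  map_D1 : ∀ p, (D₁ p).map (J p).toLinearMap = D₁ p
  map_D2 : ∀ p, (distD2 I₁ I₂ F D₁ p).map (J p).toLinearMap ≤ horizontal I₁ I₂ F p

/-- `μ`, the orthogonal complement of `J 𝒟₂` in `(ker F_*)^⊥`. -/
def distMu (J : Π x : M₁, TangentSpace I₁ x →L[ℝ] TangentSpace I₁ x)
    (F : M₁ → M₂) (D₁ : Π x : M₁, Submodule ℝ (TangentSpace I₁ x)) (p : M₁) :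
    Submodule ℝ (TangentSpace I₁ p) :=
  horizontal I₁ I₂ F p ⊓ ((distD2 I₁ I₂ F D₁ p).map (J p).toLinearMap)ᗮ

end Submersion

end RiemSubm

end

noncomputable section

namespace RiemSubm

section SmoothFields

variable {E : Type*} [NormedAddCommGroup E] [NormedSpace ℝ E] [FiniteDimensional ℝ E]
  {H : Type*} [TopologicalSpace H] {I : ModelWithCorners ℝ E H}
  {M : Type*} [TopologicalSpace M] [ChartedSpace H M] [IsManifold I ∞ M]

theorem SmoothFieldAt.mdiffAt {X : Π x : M, TangentSpace I x} {p : M}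
    (hX : SmoothFieldAt I X p) : MDiffAt (T% X) p :=
  ContMDiffAt.mdifferentiableAt hX (by simp)

theorem smoothFieldAt_extend {p : M} (v : TangentSpace I p) :
    SmoothFieldAt I (FiberBundle.extend E v) p :=
  FiberBundle.contMDiffAt_extend I E v

theorem SmoothFieldAt.congr_of_eventuallyEq {X Y : Π x : M, TangentSpace I x} {p : M}
    (hX : SmoothFieldAt I X p) (h : ∀ᶠ q in 𝓝 p, Y q = X q) : SmoothFieldAt I Y p :=
  ContMDiffAt.congr_of_eventuallyEq hX (h.mono fun q hq ↦ by simp [hq])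

theorem SmoothFieldAt.sub {X Y : Π x : M, TangentSpace I x} {p : M}
    (hX : SmoothFieldAt I X p) (hY : SmoothFieldAt I Y p) :
    SmoothFieldAt I (fun q ↦ X q - Y q) p :=
  ContMDiffAt.sub_section hX hY

theorem SmoothFieldAt.smul {X : Π x : M, TangentSpace I x} {f : M → ℝ} {p : M}
    (hX : SmoothFieldAt I X p) (hf : ContMDiffAt I 𝓘(ℝ, ℝ) ∞ f p) :
    SmoothFieldAt I (fun q ↦ f q • X q) p :=
  ContMDiffAt.smul_section hf hX

theorem SmoothFieldAt.sum {ι : Type*} {s : Finset ι} {X : ι → Π x : M, TangentSpace I x} {p : M}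
    (hX : ∀ i ∈ s, SmoothFieldAt I (X i) p) : SmoothFieldAt I (fun q ↦ ∑ i ∈ s, X i q) p :=
  ContMDiffAt.sum_section hX

theorem contMDiffAt_det {ι : Type*} [Fintype ι] [DecidableEq ι] {A : M → Matrix ι ι ℝ} {p : M}
    (hA : ∀ i j, ContMDiffAt I 𝓘(ℝ, ℝ) ∞ (fun q ↦ A q i j) p) :
    ContMDiffAt I 𝓘(ℝ, ℝ) ∞ (fun q ↦ (A q).det) p := by
  simp only [Matrix.det_apply, Units.smul_def, zsmul_eq_mul]
  exact ContMDiffAt.sum fun σ _ ↦ contMDiffAt_const.mul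
    (contMDiffAt_finsetProd fun i _ ↦ hA (σ i) i)

/-- If the functionals `β i`, which map smooth fields to smooth functions, have an invertible
matrix of values on the fields `S j` at `p`, then a smooth field `V` with values in their common
kernel at `p` can be corrected by a combination of the fields `S j`, with an overall factor, so as
to lie in the common kernel everywhere, without changing its value at `p`. -/
theorem exists_smoothField_in_ker {ι : Type*} [Fintype ι] [DecidableEq ι] {p : M}
    (β : ι → Π x : M, TangentSpace I x →ₗ[ℝ] ℝ) (S : ι → Π x : M, TangentSpace I x)
    (hβ : ∀ i (Y : Π x : M, TangentSpace I x), SmoothFieldAt I Y p →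
      ContMDiffAt I 𝓘(ℝ, ℝ) ∞ (fun q ↦ β i q (Y q)) p)
    (hS : ∀ j, SmoothFieldAt I (S j) p)
    (hdet : (Matrix.of fun i j ↦ β i p (S j p)).det ≠ 0)
    (V : Π x : M, TangentSpace I x) (hV : SmoothFieldAt I V p) (hVp : ∀ i, β i p (V p) = 0) :
    ∃ (a : M → ℝ) (c : ι → M → ℝ),
      SmoothFieldAt I (fun q ↦ a q • V q - ∑ j, c j q • S j q) p ∧
      a p • V p - ∑ j, c j p • S j p = V p ∧
      ∀ q i, β i q (a q • V q - ∑ j, c j q • S j q) = 0 := by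
  set G : M → Matrix ι ι ℝ := fun q ↦ Matrix.of fun i j ↦ β i q (S j q) with hG
  set b : M → ι → ℝ := fun q i ↦ β i q (V q) with hb
  set d : ℝ := ((G p).det)⁻¹
  have hGs : ∀ i j, ContMDiffAt I 𝓘(ℝ, ℝ) ∞ (fun q ↦ G q i j) p := fun i j ↦ hβ i _ (hS j)
  have hbs : ∀ i, ContMDiffAt I 𝓘(ℝ, ℝ) ∞ (fun q ↦ b q i) p := fun i ↦ hβ i _ hV
  have hbp : b p = 0 := funext hVp
  refine ⟨fun q ↦ d * (G q).det, fun j q ↦ d * (G q).cramer (b q) j, ?_, ?_, fun q i ↦ ?_⟩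
  · refine (hV.smul (contMDiffAt_const.mul (contMDiffAt_det hGs))).sub
      (SmoothFieldAt.sum fun j _ ↦ (hS j).smul (contMDiffAt_const.mul ?_))
    simp only [Matrix.cramer_apply]
    refine contMDiffAt_det fun i k ↦ ?_
    by_cases hk : k = j
    · subst hk
      simpa using hbs i
    · simpa [Matrix.updateCol_ne hk] using hGs i k
  · have hd : d * (G p).det = 1 := inv_mul_cancel₀ hdet
    simp [hbp, hd]
  · have h := congrFun (Matrix.mulVec_cramer (G q) (b q)) i
    simp only [Matrix.mulVec, dotProduct, Pi.smul_apply, smul_eq_mul] at h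
    simp only [map_sub, map_smul, map_sum, smul_eq_mul]
    have e : ∑ j, d * (G q).cramer (b q) j * β i q (S j q) = d * ∑ j, G q i j * (G q).cramer (b q) j := by
      rw [Finset.mul_sum]
      refine Finset.sum_congr rfl fun j _ ↦ ?_
      simp only [hG, Matrix.of_apply]
      ring
    rw [e, h]
    simp only [hb]
    ring

end SmoothFields

section Riemannian

variable {E : Type*} [NormedAddCommGroup E] [NormedSpace ℝ E] [FiniteDimensional ℝ E]
  {H : Type*} [TopologicalSpace H] {I : ModelWithCorners ℝ E H}
  {M : Type*} [TopologicalSpace M] [ChartedSpace H M] [IsManifold I ∞ M]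
  [RiemannianBundle (fun x : M ↦ TangentSpace I x)]
  [IsContMDiffRiemannianBundle I ∞ E (fun x : M ↦ TangentSpace I x)]

theorem SmoothFieldAt.inner {X Y : Π x : M, TangentSpace I x} {p : M}
    (hX : SmoothFieldAt I X p) (hY : SmoothFieldAt I Y p) :
    ContMDiffAt I 𝓘(ℝ, ℝ) ∞ (fun q ↦ ⟪X q, Y q⟫_ℝ) p :=
  ContMDiffAt.inner_bundle (E := fun x : M ↦ TangentSpace I x) (F := E) hX hY

/-- If `g(X, Y) = 0`, then `g(∇_u X, Y) = -g(X, ∇_u Y)`. -/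
theorem inner_leviCivita_eq_neg {X Y : Π x : M, TangentSpace I x} {p : M}
    (hX : SmoothFieldAt I X p) (hY : SmoothFieldAt I Y p) (h : ∀ q, ⟪X q, Y q⟫_ℝ = 0)
    (u : TangentSpace I p) :
    ⟪leviCivita I M X p u, Y p⟫_ℝ = -⟪X p, leviCivita I M Y p u⟫_ℝ := by
  have hm := leviCivita_metric (smoothFieldAt_extend u).mdiffAt hX.mdiffAt hY.mdiffAt
  simp only [h, FiberBundle.extend_apply_self] at hm
  rw [mvfderiv_const] at hm
  simp only [zero_apply] at hm
  linarith

theorem IsAlmostHermitian.inner_left {J : Π x : M, TangentSpace I x →L[ℝ] TangentSpace I x}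
    (hJ : IsAlmostHermitian I J) {p : M} (v w : TangentSpace I p) :
    ⟪J p v, w⟫_ℝ = -⟪v, J p w⟫_ℝ := by
  rw [← hJ.inner_map p v (J p w), hJ.sq, inner_neg_right, neg_neg]

theorem IsAlmostHermitian.inner_self_right
    {J : Π x : M, TangentSpace I x →L[ℝ] TangentSpace I x}
    (hJ : IsAlmostHermitian I J) {p : M} (v : TangentSpace I p) : ⟪v, J p v⟫_ℝ = 0 := by
  have h := hJ.inner_left v v
  rw [real_inner_comm] at h
  linarith

/-- A vector tangent to a smooth distribution extends to a field, smooth at the given point, with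
values in the distribution. -/
theorem IsSmoothDistribution.exists_extension {r : ℕ} {D : Π x : M, Submodule ℝ (TangentSpace I x)}
    (hD : IsSmoothDistribution I r D) {p : M} {v : TangentSpace I p} (hv : v ∈ D p) :
    ∃ X : Π x : M, TangentSpace I x, SmoothFieldAt I X p ∧ X p = v ∧ ∀ q, X q ∈ D q := by
  classical
  obtain ⟨U, hUo, hpU, X, hX⟩ := hD p
  obtain ⟨c, hc⟩ := (Submodule.mem_span_range_iff_exists_fun ℝ).1 ((hX p hpU).2.2 ▸ hv)
  refine ⟨fun q ↦ if q ∈ U then ∑ i, c i • X i q else 0, ?_, by simp [hpU, hc], fun q ↦ ?_⟩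
  · have h : SmoothFieldAt I (fun q ↦ ∑ i, c i • X i q) p :=
      SmoothFieldAt.sum fun i _ ↦ ((hX p hpU).1 i).smul (contMDiffAt_const (c := c i))
    exact h.congr_of_eventuallyEq ((hUo.eventually_mem hpU).mono fun q hq ↦ by simp [hq])
  · by_cases hq : q ∈ U
    · simp only [hq, if_true, ← (hX q hq).2.2]
      exact Submodule.sum_mem _ fun i _ ↦
        Submodule.smul_mem _ _ (Submodule.subset_span ⟨i, rfl⟩)
    · simp [hq]

/-- The rank of a smooth distribution. -/
theorem IsSmoothDistribution.finrank_eq {r : ℕ} {D : Π x : M, Submodule ℝ (TangentSpace I x)}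
    (hD : IsSmoothDistribution I r D) (p : M) : finrank ℝ (D p) = r := by
  obtain ⟨U, -, hpU, X, hX⟩ := hD p
  rw [← (hX p hpU).2.2, finrank_span_eq_card (hX p hpU).2.1, Fintype.card_fin]

/-- If `D ≤ K` is a smooth distribution, then a smooth field in `K` which is orthogonal to `D` at
`p` can be changed to a field in `K ⊓ Dᗮ` with the same value at `p`. -/
theorem IsSmoothDistribution.exists_extension_inf_orthogonal {r : ℕ}
    {D K : Π x : M, Submodule ℝ (TangentSpace I x)} (hD : IsSmoothDistribution I r D)
    (hDK : ∀ q, D q ≤ K q) {p : M} {V : Π x : M, TangentSpace I x} (hV : SmoothFieldAt I V p)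
    (hVK : ∀ q, V q ∈ K q) (hVp : V p ∈ (D p)ᗮ) :
    ∃ X : Π x : M, TangentSpace I x, SmoothFieldAt I X p ∧ X p = V p ∧
      ∀ q, X q ∈ K q ⊓ (D q)ᗮ := by
  classical
  obtain ⟨U, hUo, hpU, S, hS⟩ := hD p
  have hSD : ∀ q ∈ U, ∀ i, S i q ∈ D q := fun q hq i ↦
    (hS q hq).2.2 ▸ Submodule.subset_span ⟨i, rfl⟩
  obtain ⟨a, c, h1, h2, h3⟩ := exists_smoothField_in_ker (p := p)
    (fun i q ↦ (innerSL ℝ (S i q)).toLinearMap) S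
    (fun i Y hY ↦ ((hS p hpU).1 i).inner hY) (hS p hpU).1
    (Matrix.det_gram_ne_zero_iff_linearIndependent.2 (hS p hpU).2.1) V hV
    (fun i ↦ hVp _ (hSD p hpU i))
  refine ⟨fun q ↦ if q ∈ U then a q • V q - ∑ j, c j q • S j q else 0,
    h1.congr_of_eventuallyEq ((hUo.eventually_mem hpU).mono fun q hq ↦ by simp [hq]),
    by simpa [hpU] using h2, fun q ↦ ?_⟩
  by_cases hq : q ∈ U
  · simp only [hq, if_true]
    refine ⟨Submodule.sub_mem _ (Submodule.smul_mem _ _ (hVK q)) (Submodule.sum_mem _ fun j _ ↦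
      Submodule.smul_mem _ _ (hDK q (hSD q hq j))), ?_⟩
    rw [SetLike.mem_coe, ← (hS q hq).2.2]
    intro w hw
    induction hw using Submodule.span_induction with
    | mem x hx => obtain ⟨i, rfl⟩ := hx; exact h3 q i
    | zero => simp
    | add x y _ _ hx hy => rw [inner_add_left, hx, hy, add_zero]
    | smul c x _ hx => rw [inner_smul_left, hx, mul_zero]
  · simp [hq]

end Riemannian

section Submersion

variable {E₁ : Type*} [NormedAddCommGroup E₁] [NormedSpace ℝ E₁] [FiniteDimensional ℝ E₁]
  {H₁ : Type*} [TopologicalSpace H₁] {I₁ : ModelWithCorners ℝ E₁ H₁}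
  {M₁ : Type*} [TopologicalSpace M₁] [ChartedSpace H₁ M₁] [IsManifold I₁ ∞ M₁]
  [RiemannianBundle (fun x : M₁ ↦ TangentSpace I₁ x)]
  [IsContMDiffRiemannianBundle I₁ ∞ E₁ (fun x : M₁ ↦ TangentSpace I₁ x)]
  {E₂ : Type*} [NormedAddCommGroup E₂] [NormedSpace ℝ E₂] [FiniteDimensional ℝ E₂]
  {H₂ : Type*} [TopologicalSpace H₂] {I₂ : ModelWithCorners ℝ E₂ H₂}
  {M₂ : Type*} [TopologicalSpace M₂] [ChartedSpace H₂ M₂] [IsManifold I₂ ∞ M₂]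
  [RiemannianBundle (fun x : M₂ ↦ TangentSpace I₂ x)]
  [IsContMDiffRiemannianBundle I₂ ∞ E₂ (fun x : M₂ ↦ TangentSpace I₂ x)]
  {F : M₁ → M₂}

theorem mem_horizontal {p : M₁} {w : TangentSpace I₁ p} :
    w ∈ horizontal I₁ I₂ F p ↔ ∀ v ∈ vertical I₁ I₂ F p, ⟪v, w⟫_ℝ = 0 :=
  Submodule.mem_orthogonal _ _

/-- The rank of the vertical distribution. -/
theorem IsRiemannianSubmersion.finrank_vertical (hF : IsRiemannianSubmersion I₁ I₂ F) (p : M₁) :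
    finrank ℝ E₂ + finrank ℝ (vertical I₁ I₂ F p) = finrank ℝ E₁ := by
  have h := (mfderiv I₁ I₂ F p).toLinearMap.finrank_range_add_finrank_ker
  rwa [LinearMap.range_eq_top.2 (hF.maximalRank p), finrank_top] at h

/-- A vertical vector extends to a vertical field which is smooth at the given point. -/
theorem IsRiemannianSubmersion.exists_vertical_extension (hF : IsRiemannianSubmersion I₁ I₂ F)
    {p : M₁} {v : TangentSpace I₁ p} (hv : v ∈ vertical I₁ I₂ F p) :
    ∃ X : Π x : M₁, TangentSpace I₁ x, SmoothFieldAt I₁ X p ∧ X p = v ∧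
      ∀ q, X q ∈ vertical I₁ I₂ F q := by
  classical
  set e := trivializationAt E₂ (TangentSpace I₂ : M₂ → Type _) (F p) with he
  let b := finBasis ℝ E₂
  have hpe : F p ∈ e.baseSet := FiberBundle.mem_baseSet_trivializationAt' (F p)
  have hU : ∀ᶠ q in 𝓝 p, F q ∈ e.baseSet :=
    hF.smooth.continuous.continuousAt.eventually (e.open_baseSet.eventually_mem hpe)
  let A : Π q : M₁, TangentSpace I₁ q →ₗ[ℝ] E₂ := fun q ↦
    (e.continuousLinearMapAt ℝ (F q)).toLinearMap ∘ₗ (mfderiv I₁ I₂ F q).toLinearMap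
  have hA : ∀ Y : Π x : M₁, TangentSpace I₁ x, SmoothFieldAt I₁ Y p →
      ContMDiffAt I₁ 𝓘(ℝ, E₂) ∞ (fun q ↦ A q (Y q)) p := by
    intro Y hY
    have h1 : ContMDiffAt I₁ I₂.tangent ∞
        (fun q ↦ tangentMap I₁ I₂ F (⟨q, Y q⟩ : TangentBundle I₁ M₁)) p :=
      ContMDiffAt.comp p
        ((hF.smooth.contMDiff_tangentMap (m := ∞) (by simp)).contMDiffAt) hY
    refine ((contMDiffAt_totalSpace.1 h1).2).congr_of_eventuallyEq (hU.mono fun q hq ↦ ?_)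
    exact e.continuousLinearMapAt_apply_of_mem (R := ℝ) hq _
  have hAker : ∀ q, F q ∈ e.baseSet → ∀ w : TangentSpace I₁ q, A q w = 0 ↔
      w ∈ vertical I₁ I₂ F q := by
    intro q hq w
    refine ⟨fun h ↦ ?_, fun h ↦ ?_⟩
    · have h' := e.symmL_continuousLinearMapAt (R := ℝ) hq (mfderiv I₁ I₂ F q w)
      rw [show e.continuousLinearMapAt ℝ (F q) (mfderiv I₁ I₂ F q w) = 0 from h, map_zero] at h'
      exact h'.symm
    · change e.continuousLinearMapAt ℝ (F q) (mfderiv I₁ I₂ F q w) = 0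
      rw [show mfderiv I₁ I₂ F q w = 0 from h, map_zero]
  have hAsurj : ∀ y : E₂, ∃ w : TangentSpace I₁ p, A p w = y := by
    intro y
    obtain ⟨w, hw⟩ := hF.maximalRank p (e.symmL ℝ (F p) y)
    refine ⟨w, ?_⟩
    change e.continuousLinearMapAt ℝ (F p) (mfderiv I₁ I₂ F p w) = y
    rw [hw, e.continuousLinearMapAt_symmL hpe]
  choose s hs using hAsurj
  obtain ⟨a, c, h1, h2, h3⟩ := exists_smoothField_in_ker (p := p)
    (fun i q ↦ b.coord i ∘ₗ A q) (fun j ↦ FiberBundle.extend E₁ (s (b j)))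
    (fun i Y hY ↦ ContMDiffAt.comp (I' := 𝓘(ℝ, E₂)) p
      ((LinearMap.toContinuousLinearMap (b.coord i)).contMDiff.contMDiffAt) (hA Y hY))
    (fun j ↦ smoothFieldAt_extend _)
    (by
      have : (Matrix.of fun i j ↦ (b.coord i ∘ₗ A p)
          (FiberBundle.extend E₁ (s (b j)) p)) = (1 : Matrix _ _ ℝ) := by
        ext i j
        simp [hs, Matrix.one_apply, Finsupp.single_apply, eq_comm]
      rw [this, Matrix.det_one]
      exact one_ne_zero)
    (FiberBundle.extend E₁ v) (smoothFieldAt_extend v)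
    (fun i ↦ by simp [(hAker p hpe v).2 hv])
  set X : Π x : M₁, TangentSpace I₁ x := fun q ↦ a q • FiberBundle.extend E₁ v q -
    ∑ j, c j q • FiberBundle.extend E₁ (s (b j)) q with hX
  refine ⟨fun q ↦ if F q ∈ e.baseSet then X q else 0,
    h1.congr_of_eventuallyEq (hU.mono fun q hq ↦ by simp [hq]), ?_, fun q ↦ ?_⟩
  · simp only [hpe, if_true]
    rw [hX]
    simpa using h2
  · by_cases hq : F q ∈ e.baseSet
    · simp only [hq, if_true]
      refine (hAker q hq _).1 (b.ext_elem fun i ↦ ?_)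
      rw [map_zero]
      exact h3 q i
    · simp [hq]

/-- On vertical fields `𝒯_X Y = ℋ ∇_X Y`. -/
theorem oneillT_of_vertical {X Y : Π x : M₁, TangentSpace I₁ x}
    (hX : ∀ q, X q ∈ vertical I₁ I₂ F q) (hY : ∀ q, Y q ∈ vertical I₁ I₂ F q) (p : M₁) :
    oneillT I₁ I₂ F X Y p =
      (horizontal I₁ I₂ F p).starProjection (leviCivita I₁ M₁ Y p (X p)) := by
  have hver : ∀ {Z : Π x : M₁, TangentSpace I₁ x}, (∀ q, Z q ∈ vertical I₁ I₂ F q) →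
      verPart I₁ I₂ F Z = Z := fun hZ ↦
    funext fun q ↦ Submodule.starProjection_eq_self_iff.2 (hZ q)
  have hhor : horPart I₁ I₂ F Y = 0 := funext fun q ↦
    (Submodule.starProjection_apply_eq_zero_iff _).2 fun w hw ↦ by
      rw [real_inner_comm]
      exact mem_horizontal.1 hw _ (hY q)
  have h0 : leviCivita I₁ M₁ (0 : Π x : M₁, TangentSpace I₁ x) p = 0 := by simp
  simp only [oneillT, hver hX, hver hY, hhor, h0]
  simp

/-- For totally umbilical fibers, `g(∇_X Y, w) = g(X, Y) g(H, w)` for vertical `X`, `Y` and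
horizontal `w`. -/
theorem HasTotallyUmbilicalFibers.inner_leviCivita (hU : HasTotallyUmbilicalFibers I₁ I₂ F)
    {X Y : Π x : M₁, TangentSpace I₁ x}
    (hX : ∀ q, X q ∈ vertical I₁ I₂ F q) (hY : ∀ q, Y q ∈ vertical I₁ I₂ F q) {p : M₁}
    (hXs : SmoothFieldAt I₁ X p) (hYs : SmoothFieldAt I₁ Y p) {w : TangentSpace I₁ p}
    (hw : w ∈ horizontal I₁ I₂ F p) :
    ⟪leviCivita I₁ M₁ Y p (X p), w⟫_ℝ = ⟪X p, Y p⟫_ℝ * ⟪meanCurvature I₁ I₂ F p, w⟫_ℝ := by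
  rw [← real_inner_smul_left, ← hU X Y hX hY p hXs hYs, oneillT_of_vertical hX hY,
    Submodule.inner_starProjection_left_eq_right, Submodule.starProjection_eq_self_iff.2 hw]

/-- The mean curvature vector field of totally umbilical fibers of positive dimension is
horizontal. -/
theorem HasTotallyUmbilicalFibers.meanCurvature_mem_horizontal
    (hU : HasTotallyUmbilicalFibers I₁ I₂ F) (hF : IsRiemannianSubmersion I₁ I₂ F) {p : M₁}
    (hp : vertical I₁ I₂ F p ≠ ⊥) : meanCurvature I₁ I₂ F p ∈ horizontal I₁ I₂ F p := by
  obtain ⟨v, hv, hv0⟩ := Submodule.exists_mem_ne_zero_of_ne_bot hp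
  obtain ⟨X, hXs, rfl, hX⟩ := hF.exists_vertical_extension hv
  have h : ⟪X p, X p⟫_ℝ • meanCurvature I₁ I₂ F p ∈ horizontal I₁ I₂ F p := by
    rw [← hU X X hX hX p hXs hXs, oneillT_of_vertical hX hX]
    exact Submodule.starProjection_apply_mem _ _
  exact (Submodule.smul_mem_iff _ (inner_self_ne_zero.2 hv0)).1 h

variable {J : Π x : M₁, TangentSpace I₁ x →L[ℝ] TangentSpace I₁ x}
  {D₁ : Π x : M₁, Submodule ℝ (TangentSpace I₁ x)}

theorem IsSemiInvariantSubmersion.apply_mem_D1 (hF : IsSemiInvariantSubmersion I₁ I₂ J F D₁)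
    {p : M₁} {v : TangentSpace I₁ p} (hv : v ∈ D₁ p) : J p v ∈ D₁ p :=
  hF.map_D1 p ▸ Submodule.mem_map_of_mem (f := (J p).toLinearMap) hv

theorem IsSemiInvariantSubmersion.apply_mem_horizontal
    (hF : IsSemiInvariantSubmersion I₁ I₂ J F D₁) {p : M₁} {v : TangentSpace I₁ p}
    (hv : v ∈ distD2 I₁ I₂ F D₁ p) : J p v ∈ horizontal I₁ I₂ F p :=
  hF.map_D2 p (Submodule.mem_map_of_mem (f := (J p).toLinearMap) hv)

theorem IsSemiInvariantSubmersion.exists_distD2_extension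
    (hF : IsSemiInvariantSubmersion I₁ I₂ J F D₁) {p : M₁} {v : TangentSpace I₁ p}
    (hv : v ∈ distD2 I₁ I₂ F D₁ p) :
    ∃ X : Π x : M₁, TangentSpace I₁ x, SmoothFieldAt I₁ X p ∧ X p = v ∧
      ∀ q, X q ∈ distD2 I₁ I₂ F D₁ q := by
  obtain ⟨r, hr⟩ := hF.distribution
  obtain ⟨V, hVs, rfl, hV⟩ := hF.exists_vertical_extension hv.1
  exact hr.exists_extension_inf_orthogonal hF.le_vertical hVs hV hv.2

/-- The rank of `𝒟₂` is constant. -/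
theorem IsSemiInvariantSubmersion.exists_finrank_distD2
    (hF : IsSemiInvariantSubmersion I₁ I₂ J F D₁) :
    ∃ k, ∀ p, finrank ℝ (distD2 I₁ I₂ F D₁ p) = k := by
  obtain ⟨r, hr⟩ := hF.distribution
  refine ⟨finrank ℝ E₁ - finrank ℝ E₂ - r, fun p ↦ ?_⟩
  have h1 := Submodule.finrank_add_inf_finrank_orthogonal (hF.le_vertical p)
  have h2 := hF.finrank_vertical p
  have h3 := hr.finrank_eq p
  rw [distD2, inf_comm]
  omega

/-- A vertical vector is the sum of vectors in `𝒟₁` and `𝒟₂`. -/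
theorem IsSemiInvariantSubmersion.exists_add_eq (hF : IsSemiInvariantSubmersion I₁ I₂ J F D₁)
    {p : M₁} {v : TangentSpace I₁ p} (hv : v ∈ vertical I₁ I₂ F p) :
    ∃ v₁ ∈ D₁ p, ∃ v₂ ∈ distD2 I₁ I₂ F D₁ p, v₁ + v₂ = v := by
  obtain ⟨v₁, h₁, v₂, h₂, rfl⟩ := (D₁ p).exists_add_mem_mem_orthogonal v
  exact ⟨v₁, h₁, v₂, ⟨((vertical I₁ I₂ F p).add_mem_iff_right (hF.le_vertical p h₁)).1 hv, h₂⟩, rfl⟩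

/-- `μ` is invariant under `J`. -/
theorem IsSemiInvariantSubmersion.apply_mem_distMu
    (hF : IsSemiInvariantSubmersion I₁ I₂ J F D₁) (hJ : IsAlmostHermitian I₁ J) {p : M₁}
    {w : TangentSpace I₁ p} (hw : w ∈ distMu I₁ I₂ J F D₁ p) :
    J p w ∈ distMu I₁ I₂ J F D₁ p := by
  refine ⟨mem_horizontal.2 fun v hv ↦ ?_, ?_⟩
  · obtain ⟨v₁, h₁, v₂, h₂, rfl⟩ := hF.exists_add_eq hv
    have e₁ : ⟪J p v₁, w⟫_ℝ = 0 :=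
      mem_horizontal.1 hw.1 _ (hF.le_vertical p (hF.apply_mem_D1 h₁))
    have e₂ : ⟪J p v₂, w⟫_ℝ = 0 := hw.2 _ (Submodule.mem_map_of_mem (f := (J p).toLinearMap) h₂)
    rw [inner_add_left, ← neg_eq_zero, neg_add, ← hJ.inner_left, ← hJ.inner_left, e₁, e₂, add_zero]
  · rintro _ ⟨v, hv, rfl⟩
    exact (hJ.inner_map p v w).trans (mem_horizontal.1 hw.1 _ hv.1)

/-- If the fibers are totally umbilical and `𝒟₂` is not one-dimensional, then the mean curvature
vector is orthogonal to `J 𝒟₂`. -/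
theorem IsSemiInvariantSubmersion.inner_meanCurvature_apply_D2
    (hF : IsSemiInvariantSubmersion I₁ I₂ J F D₁) (hJ : IsKahler I₁ J)
    (hU : HasTotallyUmbilicalFibers I₁ I₂ F) {p : M₁}
    (hp : finrank ℝ (distD2 I₁ I₂ F D₁ p) ≠ 1) {u : TangentSpace I₁ p}
    (hu : u ∈ distD2 I₁ I₂ F D₁ p) : ⟪meanCurvature I₁ I₂ F p, J p u⟫_ℝ = 0 := by
  by_cases hu0 : u = 0
  · simp [hu0]
  obtain ⟨v, hv, hv0, huv⟩ : ∃ v ∈ distD2 I₁ I₂ F D₁ p, v ≠ 0 ∧ ⟪v, u⟫_ℝ = 0 := by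
    by_contra! hcon
    refine hp (finrank_eq_one_iff'.2 ⟨⟨u, hu⟩, by simpa using hu0, fun w ↦ ?_⟩)
    refine ⟨⟪(w : TangentSpace I₁ p), u⟫_ℝ / ⟪u, u⟫_ℝ, Subtype.ext ?_⟩
    by_contra hne
    refine hcon ((w : TangentSpace I₁ p) - (⟪(w : TangentSpace I₁ p), u⟫_ℝ / ⟪u, u⟫_ℝ) • u)
      (Submodule.sub_mem _ w.2 (Submodule.smul_mem _ _ hu)) (fun h ↦ hne (sub_eq_zero.1 h).symm) ?_
    rw [inner_sub_left, real_inner_smul_left, div_mul_cancel₀ _ (inner_self_ne_zero.2 hu0), sub_self]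
  obtain ⟨V, hVs, rfl, hV⟩ := hF.exists_distD2_extension hv
  obtain ⟨W, hWs, rfl, hW⟩ := hF.exists_distD2_extension hu
  have h1 := inner_leviCivita_eq_neg (hJ.smooth V p hVs) hWs
    (fun q ↦ by
      rw [real_inner_comm]
      exact mem_horizontal.1 (hF.apply_mem_horizontal (hV q)) _ (hW q).1) (V p)
  rw [sub_eq_zero.1 (hJ.parallel V p hVs (V p)), hJ.inner_left,
    hU.inner_leviCivita (fun q ↦ (hV q).1) (fun q ↦ (hV q).1) hVs hVs
      (hF.apply_mem_horizontal (hW p)),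
    real_inner_comm (leviCivita I₁ M₁ W p (V p)),
    hU.inner_leviCivita (fun q ↦ (hV q).1) (fun q ↦ (hW q).1) hVs hWs
      (hF.apply_mem_horizontal (hV p)), huv, zero_mul, neg_inj] at h1
  exact (mul_eq_zero.1 h1).resolve_left (inner_self_ne_zero.2 hv0)

/-- If the fibers are totally umbilical and `𝒟₁ ≠ 0`, then the mean curvature vector is orthogonal
to `μ`. -/
theorem IsSemiInvariantSubmersion.inner_meanCurvature_distMu
    (hF : IsSemiInvariantSubmersion I₁ I₂ J F D₁) (hJ : IsKahler I₁ J)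
    (hU : HasTotallyUmbilicalFibers I₁ I₂ F) {p : M₁} (hp : D₁ p ≠ ⊥) {w : TangentSpace I₁ p}
    (hw : w ∈ distMu I₁ I₂ J F D₁ p) : ⟪meanCurvature I₁ I₂ F p, w⟫_ℝ = 0 := by
  obtain ⟨v, hv, hv0⟩ := Submodule.exists_mem_ne_zero_of_ne_bot hp
  obtain ⟨r, hr⟩ := hF.distribution
  obtain ⟨X, hXs, rfl, hX⟩ := hr.exists_extension hv
  have hXv : ∀ q, X q ∈ vertical I₁ I₂ F q := fun q ↦ hF.le_vertical q (hX q)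
  have h1 := hU.inner_leviCivita hXv (fun q ↦ hF.le_vertical q (hF.apply_mem_D1 (hX q))) hXs
    (hJ.smooth X p hXs) (hF.apply_mem_distMu hJ.toIsAlmostHermitian hw).1
  rw [sub_eq_zero.1 (hJ.parallel X p hXs (X p)), hJ.inner_map, hJ.inner_self_right, zero_mul,
    hU.inner_leviCivita hXv hXv hXs hXs hw.1] at h1
  exact (mul_eq_zero.1 h1).resolve_left (inner_self_ne_zero.2 hv0)

end Submersion

end RiemSubm

end

theorem theorem4p3 {m n : ℕ} (hnm : n < m)
    {M₁ : Type*} [TopologicalSpace M₁] [T2Space M₁] [SecondCountableTopology M₁]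
    [ChartedSpace (EuclideanSpace ℝ (Fin m)) M₁] [IsManifold (𝓡 m) ∞ M₁]
    [RiemannianBundle (fun x : M₁ ↦ TangentSpace (𝓡 m) x)]
    [IsContMDiffRiemannianBundle (𝓡 m) ∞ (EuclideanSpace ℝ (Fin m))
      (fun x : M₁ ↦ TangentSpace (𝓡 m) x)]
    {M₂ : Type*} [TopologicalSpace M₂] [T2Space M₂] [SecondCountableTopology M₂]
    [ChartedSpace (EuclideanSpace ℝ (Fin n)) M₂] [IsManifold (𝓡 n) ∞ M₂]
    [RiemannianBundle (fun x : M₂ ↦ TangentSpace (𝓡 n) x)]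
    [IsContMDiffRiemannianBundle (𝓡 n) ∞ (EuclideanSpace ℝ (Fin n))
      (fun x : M₂ ↦ TangentSpace (𝓡 n) x)]
    (J : Π x : M₁, TangentSpace (𝓡 m) x →L[ℝ] TangentSpace (𝓡 m) x)
    (hJ : RiemSubm.IsKahler (𝓡 m) J)
    (F : M₁ → M₂) (D₁ : Π x : M₁, Submodule ℝ (TangentSpace (𝓡 m) x))
    (hF : RiemSubm.IsSemiInvariantSubmersion (𝓡 m) (𝓡 n) J F D₁)
    (hD : (∀ p, D₁ p ≠ ⊥) ∨ (∀ p, RiemSubm.distMu (𝓡 m) (𝓡 n) J F D₁ p = ⊥))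
    (hU : RiemSubm.HasTotallyUmbilicalFibers (𝓡 m) (𝓡 n) F) :
    (∀ p, Module.finrank ℝ (RiemSubm.distD2 (𝓡 m) (𝓡 n) F D₁ p) = 1) ∨
      RiemSubm.HasTotallyGeodesicFibers (𝓡 m) (𝓡 n) F := by
  obtain ⟨k, hk⟩ := hF.exists_finrank_distD2
  by_cases hk1 : k = 1
  · exact Or.inl (hk1 ▸ hk)
  refine Or.inr fun X Y hX hY p hXs hYs ↦ ?_
  rw [hU X Y hX hY p hXs hYs]
  have hver : RiemSubm.vertical (𝓡 m) (𝓡 n) F p ≠ ⊥ := fun h ↦ by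
    have := hF.finrank_vertical p
    rw [h, finrank_bot, finrank_euclideanSpace_fin, finrank_euclideanSpace_fin] at this
    omega
  have hmu : RiemSubm.meanCurvature (𝓡 m) (𝓡 n) F p ∈ RiemSubm.distMu (𝓡 m) (𝓡 n) J F D₁ p := by
    refine ⟨hU.meanCurvature_mem_horizontal hF.toIsRiemannianSubmersion hver, ?_⟩
    rintro _ ⟨u, hu, rfl⟩
    rw [real_inner_comm]
    exact hF.inner_meanCurvature_apply_D2 hJ hU (hk p ▸ hk1) hu
  have hH : RiemSubm.meanCurvature (𝓡 m) (𝓡 n) F p = 0 := by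
    rcases hD with hD | hD
    · exact inner_self_eq_zero.1 (hF.inner_meanCurvature_distMu hJ hU (hD p) hmu)
    · rwa [hD p, Submodule.mem_bot] at hmu
  rw [hH, smul_zero]
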